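/- Let $R$ be a (commutative, Noetherian) regular ring of Krull dimension $\ell$, and for an $R$-module $M$ write $M^\vee=\mathrm{Hom}_R(M,R)$. The non-free locus of $M$ is the set of $\mathfrak p\in\mathrm{Spec}\,R$ such that $M_{\mathfrak p}$ is not a free $R_{\mathfrak p}$-module; it is called zero-dimensional if, as a subspace of $\mathrm{Spec}\,R$, it has Krull dimension $0$ (so it is non-empty). The module $M$ is called $p$-spherical if $\mathrm{pd}_R M\le p$ and $\mathrm{Ext}^i_R(M,R)=0$ for $1\le i\le p-1$. It is called an $r$-syzygy if there is an exact sequence $0\to M\to P_r\to\dots\to P_1$ of $R$-modules with all $P_i$ projective. Let $0<d<\ell$ and let $M$ be a finitely generated $d$-spherical $R$-module with zero-dimensional non-free locus, such that every maximal ideal in the non-free locus has height $\ell$ (this is automatic if $R$ is local, or a polynomial ring over a field). Then: 1. if $d<\ell-1$, then $M$ is reflexive, i.e. the canonical map $M\to M^{\vee\vee}$ is bijective; 2. $M^\vee$ is $(\ell-d-1)$-spherical, and if $d<\ell-1$, then its non-free locus is zero-dimensional; 3. $M$ is an $(\ell-d)$-syzygy and $M^\vee$ is a $(d+1)$-syzygy.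 -/

import Mathlib

universe u

/-- The `R`-module `M` is `p`-spherical: its projective dimension is at most `p`, and
`Ext^i_R(M, R) = 0` for `1 ≤ i ≤ p - 1`. -/
def IsSpherical (R : Type u) [CommRing R] (p : ℕ) (M : Type u) [AddCommGroup M] [Module R M] :
    Prop :=
  CategoryTheory.HasProjectiveDimensionLE (ModuleCat.of R M) p ∧
    ∀ i : ℕ, 1 ≤ i → i < p →
      Subsingleton (CategoryTheory.Abelian.Ext (ModuleCat.of R M) (ModuleCat.of R R) i)

/-- The `R`-module `M` is an `r`-syzygy: there is an exact sequence
`0 → M → P 0 → P 1 → ⋯ → P (r - 1)` of `R`-modules with every `P i`, `i < r`, projective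
(the terms `P i` with `r ≤ i` are irrelevant). -/
def IsSyzygy (R : Type u) [CommRing R] (r : ℕ) (M : Type u) [AddCommGroup M] [Module R M] :
    Prop :=
  ∃ (P : ℕ → ModuleCat.{u} R) (ι : M →ₗ[R] P 0) (δ : ∀ i : ℕ, P i →ₗ[R] P (i + 1)),
    (∀ i : ℕ, i < r → Module.Projective R (P i)) ∧
    Function.Injective ι ∧
    (1 < r → Function.Exact ι (δ 0)) ∧
    ∀ i : ℕ, i + 2 < r → Function.Exact (δ i) (δ (i + 1))

/-- The non-free locus of `M`: the primes `p` for which `M_p` is not a free `R_p`-module. -/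
def nonFreeLocus (R : Type u) [CommRing R] (M : Type u) [AddCommGroup M] [Module R M] :
    Set (PrimeSpectrum R) :=
  (Module.freeLocus R M)ᶜ

/-- The non-free locus of `M`, as a subspace of `Spec R`, has Krull dimension `0`
(in particular it is not empty). -/
def HasZeroDimNonFreeLocus (R : Type u) [CommRing R] (M : Type u) [AddCommGroup M] [Module R M] :
    Prop :=
  topologicalKrullDim (nonFreeLocus R M) = 0

/-! ### Regular local rings: minimal generators of the maximal ideal form a regular sequence. -/

section RegularLocal

open IsLocalRing RingTheory.Sequence

variable {S : Type u} [CommRing S]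

/-! Cover `N` by a finite free `P` with kernel `K` and dualize: `0 → N^∨ → P^∨ → K^∨ → C → 0` is
exact, with `C = Ext^1(N, R)`. If `N` is `(e+1)`-spherical then `K` is `e`-spherical, so one inducts
on `e` (`IsRegularRing.dual_of_isSpherical`, with the inductive step in `dual_properties_of_ker`).
Away from the maximal ideals of height `ℓ` the module is locally free, so `C` lives only there, and
regularity gives `Ext^i(C, R) = 0` for `i < ℓ` (`IsRegularRing.subsingleton_ext_of_support_subset`).
In low degrees `C` is thus invisible, and projective dimension, Ext vanishing and biduality pass
from `K` to `N` with a shift by one. `C` can be nonzero only when `N` is `1`-spherical without being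
covered by a higher case; there `pd C ≤ ℓ` (`IsRegularRing.hasProjectiveDimensionLE`) starts the
count.

Both facts about regular rings rest on `isWeaklyRegular_of_ofList_eq_maximalIdeal`. Local freeness
at `p` is used as `FactorsThroughProjective` for some `s ∉ p`, which passes to kernels and duals
without localizing.

Dualizing a resolution of a spherical module gives a syzygy (`IsSpherical.isSyzygy_dual`). Applied
to `M` and, through `M ≅ M^∨∨`, to `M^∨`, this yields the syzygy claims. -/

theorem ringKrullDim_le_length_of_ofList_eq_maximalIdeal [IsLocalRing S] [IsNoetherianRing S]
    (xs : List S) (h : Ideal.ofList xs = maximalIdeal S) :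
    ringKrullDim S ≤ xs.length := by
  classical
  refine (ringKrullDim_le_spanFinrank_maximalIdeal S).trans ?_
  have hset : {r | r ∈ xs} = (xs.toFinset : Set S) := by ext; simp
  rw [← h, Ideal.ofList, Nat.cast_le, hset]
  refine (Submodule.spanFinrank_span_le_ncard_of_finite (Finset.finite_toSet _)).trans ?_
  rw [Set.ncard_coe_finset]
  exact xs.toFinset_card_le

theorem ofList_map_mk_eq_maximalIdeal [IsLocalRing S] {x : S} {xs : List S}
    [IsLocalRing (S ⧸ Ideal.span {x})] (h : Ideal.ofList (x :: xs) = maximalIdeal S) :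
    Ideal.ofList (xs.map (Ideal.Quotient.mk (Ideal.span {x}))) =
      maximalIdeal (S ⧸ Ideal.span {x}) := by
  have hmap : (maximalIdeal S).map (Ideal.Quotient.mk (Ideal.span {x})) =
      maximalIdeal (S ⧸ Ideal.span {x}) := by
    exact map_maximalIdeal_of_surjective _ Ideal.Quotient.mk_surjective
  rw [← hmap, ← h, Ideal.map_ofList]
  simp

theorem ringKrullDim_quotient_of_ofList_eq_maximalIdeal [IsLocalRing S] [IsNoetherianRing S]
    {x : S} {xs : List S} [IsLocalRing (S ⧸ Ideal.span {x})]
    (h : Ideal.ofList (x :: xs) = maximalIdeal S)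
    (hdim : ringKrullDim S = (x :: xs).length) :
    ringKrullDim (S ⧸ Ideal.span {x}) = xs.length := by
  have hx : x ∈ maximalIdeal S := h ▸ Ideal.subset_span (by simp)
  refine le_antisymm ?_ ?_
  · simpa using ringKrullDim_le_length_of_ofList_eq_maximalIdeal _
      (ofList_map_mk_eq_maximalIdeal h)
  · have hle := Ideal.height_le_ringKrullDim_quotient_add_one (p := maximalIdeal S) hx
    rw [maximalIdeal_height_eq_ringKrullDim, hdim] at hle
    exact ENat.WithBot.add_le_add_one_right_iff.mp (by simpa using hle)

/-- Replace `x` by `x + y ^ (i + 1)`. There are finitely many minimal primes, so if all these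
elements generated one, two would generate the same `p`. Their difference forces `y ∈ p`, and the
maximal ideal would then need fewer generators than the dimension. -/
theorem exists_ofList_eq_maximalIdeal_of_span_notMem_minimalPrimes [IsLocalRing S]
    [IsNoetherianRing S] {x : S} {xs : List S} (h : Ideal.ofList (x :: xs) = maximalIdeal S)
    (hdim : ringKrullDim S = (x :: xs).length) :
    ∃ z : S, ∃ zs : List S, zs.length = xs.length ∧ Ideal.ofList (z :: zs) = maximalIdeal S ∧
      Ideal.span {z} ∉ minimalPrimes S := by
  rcases xs with _ | ⟨y, ys⟩
  · refine ⟨x, [], rfl, h, fun hmin ↦ ?_⟩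
    rw [Ideal.ofList_singleton] at h
    have := hmin.1.1
    have hh := maximalIdeal_height_eq_ringKrullDim (R := S)
    rw [hdim, ← h, Ideal.height_eq_zero_iff.mpr hmin] at hh
    simp at hh
  · have hy : y ∈ maximalIdeal S := h ▸ Ideal.subset_span (by simp)
    have hgen (i : ℕ) : Ideal.ofList ((x + y ^ (i + 1)) :: y :: ys) = maximalIdeal S := by
      rw [← h]
      simp only [Ideal.ofList_cons, ← sup_assoc]
      congr 1
      rw [← Ideal.span_union, ← Ideal.span_union]
      refine le_antisymm (Ideal.span_le.mpr ?_) (Ideal.span_le.mpr ?_)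
      · rintro a (ha | ha) <;> rw [Set.mem_singleton_iff.mp ha]
        · exact add_mem (Ideal.subset_span (by simp))
            (Ideal.pow_mem_of_mem _ (Ideal.subset_span (by simp)) _ i.succ_pos)
        · exact Ideal.subset_span (by simp)
      · rintro a (ha | ha) <;> rw [Set.mem_singleton_iff.mp ha]
        · have h1 : x + y ^ (i + 1) ∈ Ideal.span ({x + y ^ (i + 1)} ∪ {y}) :=
            Ideal.subset_span (by simp)
          have h2 : y ^ (i + 1) ∈ Ideal.span ({x + y ^ (i + 1)} ∪ {y}) :=
            Ideal.pow_mem_of_mem _ (Ideal.subset_span (by simp)) _ i.succ_pos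
          simpa using sub_mem h1 h2
        · exact Ideal.subset_span (by simp)
    by_contra! hcon
    have hmin (i : ℕ) : Ideal.span {x + y ^ (i + 1)} ∈ minimalPrimes S :=
      hcon _ (y :: ys) rfl (hgen i)
    have := (minimalPrimes.finite_of_isNoetherianRing S).to_subtype
    obtain ⟨i, j, hij, heq⟩ := Finite.exists_ne_map_eq_of_infinite
      (fun i : ℕ ↦ (⟨_, hmin i⟩ : minimalPrimes S))
    wlog hlt : i < j generalizing i j
    · exact this j i hij.symm heq.symm (by omega)
    have heq' : Ideal.span {x + y ^ (i + 1)} = Ideal.span {x + y ^ (j + 1)} :=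
      congrArg Subtype.val heq
    set p := Ideal.span {x + y ^ (i + 1)} with hp
    have hprime : p.IsPrime := (hmin i).1.1
    have h1 : x + y ^ (i + 1) ∈ p := Ideal.subset_span rfl
    have h2 : x + y ^ (j + 1) ∈ p := heq' ▸ Ideal.subset_span rfl
    obtain ⟨k, rfl⟩ := Nat.exists_eq_add_of_lt hlt
    have hunit : IsUnit (1 - y ^ (k + 1)) := by
      by_contra hn
      have h3 := add_mem ((mem_maximalIdeal _).mpr hn)
        (Ideal.pow_mem_of_mem _ hy (k + 1) k.succ_pos)
      rw [sub_add_cancel] at h3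
      exact (Ideal.ne_top_iff_one _).mp (maximalIdeal.isMaximal S).ne_top h3
    have h3 : y ^ (i + 1) * (1 - y ^ (k + 1)) ∈ p := by
      have := sub_mem h1 h2
      convert this using 1
      ring
    have hyp : y ∈ p := by
      rcases hprime.mem_or_mem h3 with h4 | h4
      · exact hprime.mem_of_pow_mem _ h4
      · exact absurd (Ideal.eq_top_of_isUnit_mem _ h4 hunit) hprime.ne_top
    have hgen' : Ideal.ofList ((x + y ^ (i + 1)) :: ys) = maximalIdeal S := by
      rw [← hgen i, Ideal.ofList_cons, Ideal.ofList_cons, Ideal.ofList_cons, ← sup_assoc,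
        ← hp, sup_eq_left.mpr ((Ideal.span_singleton_le_iff_mem _).mpr hyp)]
    have hle := ringKrullDim_le_length_of_ofList_eq_maximalIdeal _ hgen'
    rw [hdim] at hle
    simp only [List.length_cons, Nat.cast_le] at hle
    omega

/-- By induction `S/(z)` is a domain, so `(z)` is prime but not minimal. A minimal prime `q` inside
it omits `z`, whence `q = zq`, and Nakayama gives `q = 0`. -/
theorem isDomain_of_ofList_eq_maximalIdeal (n : ℕ) {S : Type u} [CommRing S] [IsLocalRing S]
    [IsNoetherianRing S] (xs : List S) (hn : xs.length = n)
    (h : Ideal.ofList xs = maximalIdeal S) (hdim : ringKrullDim S = xs.length) : IsDomain S := by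
  induction n generalizing S with
  | zero =>
    obtain rfl := List.length_eq_zero_iff.mp hn
    rw [Ideal.ofList_nil] at h
    exact (isField_iff_maximalIdeal_eq.mpr h.symm).isDomain
  | succ n ih =>
    rcases xs with _ | ⟨x, xs⟩
    · simp at hn
    obtain ⟨z, zs, hlen, hgen, hmin⟩ :=
      exists_ofList_eq_maximalIdeal_of_span_notMem_minimalPrimes h hdim
    have hz : z ∈ maximalIdeal S := hgen ▸ Ideal.subset_span (by simp)
    have hle : Ideal.span {z} ≤ maximalIdeal S := (Ideal.span_singleton_le_iff_mem _).mpr hz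
    have : Nontrivial (S ⧸ Ideal.span {z}) := Ideal.Quotient.nontrivial_iff.mpr
      (ne_top_of_le_ne_top (maximalIdeal.isMaximal S).ne_top hle)
    have : IsLocalRing (S ⧸ Ideal.span {z}) :=
      .of_surjective' (Ideal.Quotient.mk _) Ideal.Quotient.mk_surjective
    have hdim' : ringKrullDim S = (z :: zs).length := by simpa [hlen] using hdim
    have hdom : IsDomain (S ⧸ Ideal.span {z}) :=
      ih (zs.map (Ideal.Quotient.mk _)) (by simpa [hlen] using hn)
        (ofList_map_mk_eq_maximalIdeal hgen)
        (by simpa using ringKrullDim_quotient_of_ofList_eq_maximalIdeal hgen hdim')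
    have hprime : (Ideal.span {z}).IsPrime := (Ideal.Quotient.isDomain_iff_prime _).mp hdom
    obtain ⟨q, hq, hqz⟩ := Ideal.exists_minimalPrimes_le (bot_le : ⊥ ≤ Ideal.span {z})
    have hqp : q.IsPrime := hq.1.1
    have hzq : z ∉ q := fun hzq ↦ hmin <| by
      rwa [le_antisymm hqz ((Ideal.span_singleton_le_iff_mem _).mpr hzq)] at hq
    have hq0 : q = ⊥ := by
      refine Submodule.eq_bot_of_le_smul_of_le_jacobson_bot (Ideal.span {z}) q
        (IsNoetherian.noetherian q) (fun a ha ↦ ?_) (hle.trans (maximalIdeal_le_jacobson _))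
      obtain ⟨b, rfl⟩ := Ideal.mem_span_singleton'.mp (hqz ha)
      rw [mul_comm]
      exact Submodule.smul_mem_smul (Ideal.subset_span rfl)
        ((hqp.mem_or_mem ha).resolve_right hzq)
    rw [hq0] at hqp
    exact IsDomain.of_bot_isPrime S

theorem isWeaklyRegular_of_ofList_eq_maximalIdeal (n : ℕ) {S : Type u} [CommRing S]
    [IsLocalRing S] [IsNoetherianRing S] (xs : List S) (hn : xs.length = n)
    (h : Ideal.ofList xs = maximalIdeal S) (hdim : ringKrullDim S = xs.length) :
    IsWeaklyRegular S xs := by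
  induction n generalizing S with
  | zero =>
    obtain rfl := List.length_eq_zero_iff.mp hn
    simp
  | succ n ih =>
    rcases xs with _ | ⟨x, xs⟩
    · simp at hn
    have hdom := isDomain_of_ofList_eq_maximalIdeal _ _ rfl h hdim
    have hx : x ∈ maximalIdeal S := h ▸ Ideal.subset_span (by simp)
    have hle : Ideal.span {x} ≤ maximalIdeal S := (Ideal.span_singleton_le_iff_mem _).mpr hx
    have : Nontrivial (S ⧸ Ideal.span {x}) := Ideal.Quotient.nontrivial_iff.mpr
      (ne_top_of_le_ne_top (maximalIdeal.isMaximal S).ne_top hle)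
    have : IsLocalRing (S ⧸ Ideal.span {x}) :=
      .of_surjective' (Ideal.Quotient.mk _) Ideal.Quotient.mk_surjective
    have hx0 : x ≠ 0 := by
      rintro rfl
      have hgen : Ideal.ofList xs = maximalIdeal S := by
        rw [← h, Ideal.ofList_cons, Ideal.span_singleton_eq_bot.mpr rfl, bot_sup_eq]
      have hle := ringKrullDim_le_length_of_ofList_eq_maximalIdeal _ hgen
      rw [hdim] at hle
      simp only [List.length_cons, Nat.cast_le] at hle
      omega
    have hreg : IsWeaklyRegular (S ⧸ Ideal.span {x})
        (xs.map (algebraMap S (S ⧸ Ideal.span {x}))) :=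
      ih (xs.map (Ideal.Quotient.mk _)) (by simpa using hn)
        (ofList_map_mk_eq_maximalIdeal h)
        (by simpa using ringKrullDim_quotient_of_ofList_eq_maximalIdeal h hdim)
    rw [isWeaklyRegular_map_algebraMap_iff] at hreg
    refine .cons (.of_right_eq_zero_of_smul fun a ha ↦ ?_) ?_
    · exact (mul_eq_zero.mp ha).resolve_left hx0
    · refine (LinearEquiv.isWeaklyRegular_congr (Submodule.quotEquivOfEq _ _ ?_) xs).mp hreg
      rw [← Submodule.ideal_span_singleton_smul]
      simp

end RegularLocal

/-! ### Projective dimension over regular rings is at most the Krull dimension. -/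

section ProjectiveDimension

open IsLocalRing RingTheory.Sequence CategoryTheory

/-- The depth lemma in sequence form: a syzygy is regular along one more element than the module it
resolves. -/
theorem isWeaklyRegular_append_singleton_of_exact {S : Type u} [CommRing S]
    {K F N : Type u} [AddCommGroup K] [Module S K] [AddCommGroup F] [Module S F]
    [AddCommGroup N] [Module S N] {f : K →ₗ[S] F} {g : F →ₗ[S] N} (hf : Function.Injective f)
    (hfg : Function.Exact f g) (hg : Function.Surjective g) {rs : List S} {r : S}
    (hN : IsWeaklyRegular N rs) (hF : IsWeaklyRegular F (rs ++ [r])) :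
    IsWeaklyRegular K (rs ++ [r]) := by
  induction rs generalizing K F N with
  | nil =>
    rw [List.nil_append, isWeaklyRegular_singleton_iff] at hF ⊢
    exact hF.of_injective f hf
  | cons x rs ih =>
    rw [List.cons_append, isWeaklyRegular_cons_iff] at hF ⊢
    rw [isWeaklyRegular_cons_iff] at hN
    refine ⟨hF.1.of_injective f hf, ih (f := QuotSMulTop.map x f) (g := QuotSMulTop.map x g) ?_
      (QuotSMulTop.map_exact x hfg hg) (QuotSMulTop.map_surjective x hg) hN.2 hF.2⟩
    -- Since `x` is regular on `N`, reduction mod `x` keeps `0 → K → F → N` exact, so `K/xK → F/xF`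
    -- stays injective.
    have h0 : Function.Exact (0 : PUnit.{u + 1} →ₗ[S] K) f := by
      intro y
      rw [map_eq_zero_iff f hf]
      simp [eq_comm]
    have := QuotSMulTop.map_first_exact_on_four_term_exact_of_isSMulRegular_last h0 hfg hN.1
    rw [injective_iff_map_eq_zero]
    intro y hy
    obtain ⟨z, rfl⟩ := (this y).mp hy
    obtain ⟨z, rfl⟩ := Submodule.mkQ_surjective _ z
    simp

theorem free_of_isWeaklyRegular_of_ofList_eq_maximalIdeal (n : ℕ) {S : Type u} [CommRing S]
    [IsLocalRing S] [IsNoetherianRing S] (xs : List S) (hn : xs.length = n)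
    (h : Ideal.ofList xs = maximalIdeal S) (N : Type u) [AddCommGroup N] [Module S N]
    [Module.Finite S N] (hN : IsWeaklyRegular N xs) : Module.Free S N := by
  induction n generalizing S N with
  | zero =>
    obtain rfl := List.length_eq_zero_iff.mp hn
    rw [Ideal.ofList_nil] at h
    let := (isField_iff_maximalIdeal_eq.mpr h.symm).toField
    exact Module.Free.of_divisionRing S N
  | succ n ih =>
    rcases xs with _ | ⟨x, xs⟩
    · simp at hn
    have hx : x ∈ maximalIdeal S := h ▸ Ideal.subset_span (by simp)
    have hle : Ideal.span {x} ≤ maximalIdeal S := (Ideal.span_singleton_le_iff_mem _).mpr hx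
    have : Nontrivial (S ⧸ Ideal.span {x}) := Ideal.Quotient.nontrivial_iff.mpr
      (ne_top_of_le_ne_top (maximalIdeal.isMaximal S).ne_top hle)
    have : IsLocalRing (S ⧸ Ideal.span {x}) :=
      .of_surjective' (Ideal.Quotient.mk _) Ideal.Quotient.mk_surjective
    rw [isWeaklyRegular_cons_iff'] at hN
    have := Module.finitePresentation_of_finite S N
    have := Module.Finite.of_restrictScalars_finite S (S ⧸ Ideal.span {x}) (QuotSMulTop x N)
    exact (Module.free_quotSMulTop_iff_free S N (maximalIdeal_le_jacobson _ hx) hN.1).mp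
      (ih (xs.map (Ideal.Quotient.mk _)) (by simpa using hn) (ofList_map_mk_eq_maximalIdeal h)
        _ hN.2)

theorem isWeaklyRegular_of_free {S : Type u} [CommRing S] {xs : List S}
    (h : IsWeaklyRegular S xs) (F : Type u) [AddCommGroup F] [Module S F] [Module.Flat S F] :
    IsWeaklyRegular F xs :=
  (LinearEquiv.isWeaklyRegular_congr (TensorProduct.rid S F) xs).mp
    h.isWeaklyRegular_lTensor

/-- Each syzygy gains one regular element; once the whole sequence is regular, the module is free.
-/
theorem hasProjectiveDimensionLE_of_isWeaklyRegular_take {S : Type u} [CommRing S]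
    [IsLocalRing S] [IsNoetherianRing S] {xs : List S}
    (h : Ideal.ofList xs = maximalIdeal S) (hS : IsWeaklyRegular S xs) (j : ℕ)
    (hj : j ≤ xs.length) (N : Type u) [AddCommGroup N] [Module S N] [Module.Finite S N]
    (hN : IsWeaklyRegular N (xs.take (xs.length - j))) :
    HasProjectiveDimensionLE (ModuleCat.of S N) j := by
  induction j generalizing N with
  | zero =>
    rw [Nat.sub_zero, List.take_length] at hN
    have := free_of_isWeaklyRegular_of_ofList_eq_maximalIdeal _ xs rfl h N hN
    rw [← projective_iff_hasProjectiveDimensionLE_zero, ← IsProjective.iff_projective]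
    infer_instance
  | succ j ih =>
    obtain ⟨F, _, _, _, _, f, hf⟩ := Module.exists_finite_presentation S N
    have hex := LinearMap.shortExact_shortComplexKer hf
    have hproj : Projective f.shortComplexKer.X₂ :=
      ModuleCat.projective_of_categoryTheory_projective _
    rw [HasProjectiveDimensionLE, show ModuleCat.of S N = f.shortComplexKer.X₃ from rfl,
      hex.hasProjectiveDimensionLT_X₃_iff j hproj]
    refine ih (by omega) (LinearMap.ker f) ?_
    have hlt : xs.length - (j + 1) < xs.length := by omega
    have htake : xs.take (xs.length - j) =
        xs.take (xs.length - (j + 1)) ++ [xs[xs.length - (j + 1)]] := by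
      rw [← List.take_succ_eq_append_getElem hlt]
      congr 1
      omega
    rw [htake]
    refine isWeaklyRegular_append_singleton_of_exact (f := (LinearMap.ker f).subtype) (g := f)
      Subtype.val_injective (LinearMap.exact_subtype_ker_map f) hf hN ?_
    rw [← htake]
    have hF := isWeaklyRegular_of_free hS F
    rw [← List.take_append_drop (xs.length - j) xs, isWeaklyRegular_append_iff] at hF
    exact hF.1

theorem exists_ofList_eq_maximalIdeal (S : Type u) [CommRing S] [IsRegularLocalRing S] :
    ∃ xs : List S, Ideal.ofList xs = maximalIdeal S ∧ ringKrullDim S = xs.length := by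
  have hfg := (maximalIdeal S).fg_of_isNoetherianRing
  have hfin := Submodule.FG.finite_generators hfg
  refine ⟨hfin.toFinset.toList, ?_, ?_⟩
  · rw [Ideal.ofList]
    convert! (maximalIdeal S).span_generators
    simp
  · rw [← IsRegularLocalRing.spanFinrank_maximalIdeal, ← Submodule.FG.generators_ncard hfg,
      Finset.length_toList, Set.ncard_eq_toFinset_card _ hfin]

theorem IsRegularLocalRing.hasProjectiveDimensionLE {S : Type u} [CommRing S]
    [IsRegularLocalRing S] {l : ℕ} (hl : ringKrullDim S ≤ l) (N : Type u) [AddCommGroup N]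
    [Module S N] [Module.Finite S N] : HasProjectiveDimensionLE (ModuleCat.of S N) l := by
  obtain ⟨xs, hgen, hdim⟩ := exists_ofList_eq_maximalIdeal S
  have := hasProjectiveDimensionLE_of_isWeaklyRegular_take hgen
    (isWeaklyRegular_of_ofList_eq_maximalIdeal _ xs rfl hgen hdim) xs.length le_rfl N (by simp)
  rw [hdim, Nat.cast_le] at hl
  exact hasProjectiveDimensionLT_of_ge _ _ _ (Nat.add_le_add_right hl 1)

theorem IsRegularRing.hasProjectiveDimensionLE {R : Type u} [CommRing R] [IsRegularRing R]
    {l : ℕ} (hl : ringKrullDim R ≤ l) (N : Type u) [AddCommGroup N]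
    [Module R N] [Module.Finite R N] : HasProjectiveDimensionLE (ModuleCat.of R N) l := by
  rw [ModuleCat.hasProjectiveDimensionLE_iff_forall_maximalSpectrum]
  intro m
  have hle : ringKrullDim (Localization.AtPrime m.asIdeal) ≤ l := by
    rw [IsLocalization.AtPrime.ringKrullDim_eq_height m.asIdeal]
    exact m.asIdeal.height_le_ringKrullDim_of_ne_top m.isMaximal.ne_top |>.trans hl
  have : Module.Finite (Localization.AtPrime m.asIdeal)
    ((ModuleCat.of R N).localizedModule m.asIdeal.primeCompl) :=
    have : Module.Finite (Localization m.asIdeal.primeCompl)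
        (LocalizedModule m.asIdeal.primeCompl N) :=
      Module.Finite.of_isLocalizedModule m.asIdeal.primeCompl
        (LocalizedModule.mkLinearMap m.asIdeal.primeCompl N)
    Module.Finite.equiv (Shrink.linearEquiv (Localization m.asIdeal.primeCompl)
      (LocalizedModule m.asIdeal.primeCompl N)).symm
  exact IsRegularLocalRing.hasProjectiveDimensionLE hle _

end ProjectiveDimension

/-! ### Vanishing of `Ext(E, R)` for `E` supported at maximal ideals of height `ℓ`. -/

section ExtVanishing

open IsLocalRing RingTheory.Sequence CategoryTheory Abelian TensorProduct Pointwise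

variable {R : Type u} [CommRing R]

theorem CategoryTheory.Abelian.Ext.smul_eq_zero_of_mem_annihilator_source {M N : ModuleCat.{u} R}
    {r : R} (hr : r ∈ Module.annihilator R M) {n : ℕ} (e : Ext M N n) : r • e = 0 := by
  have h0 : r • 𝟙 M = 0 := by
    simp [← ModuleCat.lsmul_eq_smul_id, Module.mem_annihilator_iff_lsmul_eq_zero.mp hr]
  have : r • e = (Ext.mk₀ (r • 𝟙 M)).comp e (zero_add n) := by simp [Ext.mk₀_smul]
  simp [this, h0]

theorem CategoryTheory.Abelian.Ext.smul_eq_zero_of_mem_annihilator_target {M N : ModuleCat.{u} R}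
    {r : R} (hr : r ∈ Module.annihilator R N) {n : ℕ} (e : Ext M N n) : r • e = 0 := by
  have h0 : r • 𝟙 N = 0 := by
    simp [← ModuleCat.lsmul_eq_smul_id, Module.mem_annihilator_iff_lsmul_eq_zero.mp hr]
  have : r • e = e.comp (Ext.mk₀ (r • 𝟙 N)) (add_zero n) := by simp [Ext.mk₀_smul]
  simp [this, h0]

theorem subsingleton_ext_quotient_of_smul_eq_zero {m : Ideal R} [m.IsMaximal]
    {T : ModuleCat.{u} R} {s : R} (hs : s ∉ m) (hT : s ∈ Module.annihilator R T) (n : ℕ) :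
    Subsingleton (Ext (ModuleCat.of R (R ⧸ m)) T n) := by
  refine subsingleton_of_forall_eq 0 fun e ↦ ?_
  obtain ⟨t, ht⟩ := Ideal.IsMaximal.exists_inv ‹m.IsMaximal› hs
  obtain ⟨i, hi, h1⟩ := ht
  have hi0 : i • e = 0 := Ext.smul_eq_zero_of_mem_annihilator_source
    (by simpa [Ideal.annihilator_quotient] using hi) e
  rw [← one_smul R e, ← h1, add_smul, hi0, mul_smul,
    Ext.smul_eq_zero_of_mem_annihilator_target hT, smul_zero, add_zero]

theorem subsingleton_ext_congr_left {A B C : Type u} [AddCommGroup A] [Module R A]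
    [AddCommGroup B] [Module R B] [AddCommGroup C] [Module R C] (e : A ≃ₗ[R] B) {n : ℕ}
    (h : Subsingleton (Ext (ModuleCat.of R B) (ModuleCat.of R C) n)) :
    Subsingleton (Ext (ModuleCat.of R A) (ModuleCat.of R C) n) := by
  refine subsingleton_of_forall_eq 0 fun x ↦ ?_
  rw [← x.mk₀_id_comp, ← e.toModuleIso.hom_inv_id, ← Ext.mk₀_comp_mk₀,
    Ext.comp_assoc_of_second_deg_zero,
    Subsingleton.elim ((Ext.mk₀ e.toModuleIso.inv).comp x (zero_add n)) 0, Ext.comp_zero]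

theorem exists_smul_eq_zero_of_isSMulRegular_localization [IsNoetherianRing R] (m : Ideal R)
    [m.IsPrime] (N : Type u) [AddCommGroup N] [Module R N] [Module.Finite R N] {x : R}
    (hx : IsSMulRegular (Localization.AtPrime m ⊗[R] N) x) :
    ∃ s ∉ m, ∀ v : N, x • v = 0 → s • v = 0 := by
  let T := LinearMap.ker (LinearMap.lsmul R N x)
  obtain ⟨s, hs⟩ := Module.Finite.exists_smul_of_comp_eq_of_isLocalizedModule m.primeCompl
    (TensorProduct.mk R (Localization.AtPrime m) N 1) T.subtype 0 (by
      ext v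
      have hv : x • (v : N) = 0 := v.2
      refine hx ?_
      simp [← TensorProduct.tmul_smul, hv])
  exact ⟨s, s.2, fun v hv ↦ by
    simpa using! LinearMap.congr_fun hs ⟨v, hv⟩⟩

/-- Multiplication by `x ∈ m` kills `Ext(R/m, N)` and factors as `N → xN → N`. The second map is
injective on `Ext^i` by induction applied to `N/xN`, the first because its kernel vanishes at `m`.
-/
theorem subsingleton_ext_quotient_of_isWeaklyRegular_localization [IsNoetherianRing R]
    (m : Ideal R) [m.IsMaximal] (xs : List R) (hxs : ∀ x ∈ xs, x ∈ m) (N : Type u)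
    [AddCommGroup N] [Module R N] [Module.Finite R N]
    (hN : IsWeaklyRegular (Localization.AtPrime m ⊗[R] N) xs) (i : ℕ) (hi : i < xs.length) :
    Subsingleton (Ext (ModuleCat.of R (R ⧸ m)) (ModuleCat.of R N) i) := by
  induction xs generalizing N i with
  | nil => simp at hi
  | cons x xs ih =>
    rw [isWeaklyRegular_cons_iff] at hN
    have hquot (j : ℕ) (hj : j < xs.length) := ih (fun y hy ↦ hxs y (by simp [hy]))
      (QuotSMulTop x N) ((LinearEquiv.isWeaklyRegular_congr
        (QuotSMulTop.tensorQuotSMulTopEquivQuotSMulTop x _ N) xs).mpr hN.2) j hj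
    obtain ⟨s, hs, hsv⟩ := exists_smul_eq_zero_of_isSMulRegular_localization m N hN.1
    let q := (x • (⊤ : Submodule R N)).mkQ
    have hq := LinearMap.shortExact_shortComplexKer
      (Submodule.mkQ_surjective _ : Function.Surjective q)
    let p : N →ₗ[R] LinearMap.ker q := (LinearMap.lsmul R N x).codRestrict _ fun v ↦ by
      simpa [q] using Submodule.smul_mem_pointwise_smul v x ⊤ trivial
    have hp : Function.Surjective p := by
      rintro ⟨w, hw⟩
      obtain ⟨v, -, rfl⟩ := (Submodule.mem_smul_pointwise_iff_exists _ _ _).mp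
        (by simpa [q] using hw)
      exact ⟨v, rfl⟩
    have hp' := LinearMap.shortExact_shortComplexKer hp
    refine subsingleton_of_forall_eq 0 fun e ↦ ?_
    have hcomp : ModuleCat.ofHom p ≫ q.shortComplexKer.f = x • 𝟙 (ModuleCat.of R N) := rfl
    have hpe : (e.comp (Ext.mk₀ (ModuleCat.ofHom p)) (add_zero i)) = 0 := by
      have h0 : (e.comp (Ext.mk₀ (ModuleCat.ofHom p)) (add_zero i)).comp
          (Ext.mk₀ q.shortComplexKer.f) (add_zero i) = 0 := by
        rw [Ext.comp_assoc_of_second_deg_zero, Ext.mk₀_comp_mk₀, hcomp, Ext.mk₀_smul]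
        simp only [Ext.comp_smul, Ext.comp_mk₀_id]
        exact Ext.smul_eq_zero_of_mem_annihilator_source
          (by simpa [Ideal.annihilator_quotient] using hxs x (by simp)) e
      rcases i with _ | i
      · have := hq.mono_f
        exact Ext.postcomp_mk₀_injective_of_mono _ q.shortComplexKer.f (by simpa using h0)
      · obtain ⟨y, hy⟩ := Ext.covariant_sequence_exact₁ _ hq _ h0 rfl
        have := hquot i (by simpa using hi)
        rw [← hy, Subsingleton.elim y 0, Ext.zero_comp]
    obtain ⟨y, hy⟩ := Ext.covariant_sequence_exact₂ _ hp' e hpe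
    -- Regularity holds only after localizing, so `ker p` may be nonzero; but `s ∉ m` kills it,
    -- while `m` kills `R/m`.
    have : Subsingleton (Ext (ModuleCat.of R (R ⧸ m)) p.shortComplexKer.X₁ i) :=
      subsingleton_ext_quotient_of_smul_eq_zero hs (Module.mem_annihilator.mpr fun (v : LinearMap.ker p) ↦
        Subtype.ext (hsv v.1 (congrArg Subtype.val (LinearMap.mem_ker.mp v.2)))) i
    rw [← hy, Subsingleton.elim y 0, Ext.zero_comp]

theorem exists_list_isWeaklyRegular_localization [IsRegularRing R] (m : Ideal R) [m.IsPrime]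
    {l : ℕ} (hm : m.height = l) :
    ∃ xs : List R, xs.length = l ∧ (∀ x ∈ xs, x ∈ m) ∧
      IsWeaklyRegular (Localization.AtPrime m) xs := by
  obtain ⟨ys, hgen, hdim⟩ := exists_ofList_eq_maximalIdeal (Localization.AtPrime m)
  have hfrac (y : Localization.AtPrime m) :
      ∃ x : R, Associated (algebraMap R (Localization.AtPrime m) x) y := by
    obtain ⟨x, s, rfl⟩ := IsLocalization.exists_mk'_eq m.primeCompl y
    refine ⟨x, Associated.symm ⟨(IsLocalization.map_units (Localization.AtPrime m) s).unit, ?_⟩⟩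
    simp
  choose c hc using hfrac
  have hgen' : Ideal.ofList ((ys.map c).map (algebraMap R (Localization.AtPrime m))) =
      maximalIdeal (Localization.AtPrime m) := by
    rw [← hgen]
    clear hgen hdim
    induction ys with
    | nil => simp
    | cons y ys ih =>
      simp only [List.map_cons, Ideal.ofList_cons, ih]
      rw [le_antisymm (Ideal.span_singleton_le_span_singleton.mpr (hc y).dvd')
        (Ideal.span_singleton_le_span_singleton.mpr (hc y).dvd)]
  have hdim' : ringKrullDim (Localization.AtPrime m) =
      ((ys.map c).map (algebraMap R (Localization.AtPrime m))).length := by simpa using hdim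
  refine ⟨ys.map c, ?_, fun x hx ↦ ?_, ?_⟩
  · rw [IsLocalization.AtPrime.ringKrullDim_eq_height m, hm] at hdim
    simpa using (Nat.cast_injective (R := WithBot ℕ∞) hdim).symm
  · rw [← IsLocalization.AtPrime.to_map_mem_maximal_iff (Localization.AtPrime m) m, ← hgen']
    exact Ideal.subset_span (List.mem_map_of_mem hx)
  · rw [← isWeaklyRegular_map_algebraMap_iff (S := Localization.AtPrime m)]
    exact isWeaklyRegular_of_ofList_eq_maximalIdeal _ _ rfl hgen' hdim'

theorem IsRegularRing.subsingleton_ext_quotient [IsRegularRing R] (m : Ideal R) [m.IsMaximal]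
    {l : ℕ} (hm : m.height = l) (i : ℕ) (hi : i < l) :
    Subsingleton (Ext (ModuleCat.of R (R ⧸ m)) (ModuleCat.of R R) i) := by
  obtain ⟨xs, rfl, hmem, hreg⟩ := exists_list_isWeaklyRegular_localization m hm
  exact subsingleton_ext_quotient_of_isWeaklyRegular_localization m xs hmem R
    ((LinearEquiv.isWeaklyRegular_congr (TensorProduct.rid R _) xs).mpr hreg) i hi

theorem ModuleCat.shortExact_of_function_exact {A B C : Type u} [AddCommGroup A] [Module R A]
    [AddCommGroup B] [Module R B] [AddCommGroup C] [Module R C] {f : A →ₗ[R] B} {g : B →ₗ[R] C}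
    (hf : Function.Injective f) (hfg : Function.Exact f g) (hg : Function.Surjective g) :
    (ModuleCat.shortComplexOfCompEqZero f g hfg.linearMap_comp_eq_zero).ShortExact :=
  { exact := ModuleCat.shortComplex_exact _ hfg
    mono_f := (ModuleCat.mono_iff_injective _).mpr hf
    epi_g := (ModuleCat.epi_iff_surjective _).mpr hg }

/-- Dévissage to `R/p`: such a `p` lies in the support, hence is maximal of height `l`. -/
theorem IsRegularRing.subsingleton_ext_of_support_subset [IsRegularRing R] {l : ℕ}
    (E : Type u) [AddCommGroup E] [Module R E] [hE : Module.Finite R E]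
    (hsupp : ∀ p ∈ Module.support R E, p.asIdeal.IsMaximal ∧ p.asIdeal.height = l) (i : ℕ)
    (hi : i < l) : Subsingleton (Ext (ModuleCat.of R E) (ModuleCat.of R R) i) := by
  induction hE using IsNoetherianRing.induction_on_isQuotientEquivQuotientPrime R with
  | subsingleton N =>
    have : HasProjectiveDimensionLT (ModuleCat.of R N) 0 :=
      (ModuleCat.isZero_of_subsingleton _).hasProjectiveDimensionLT_zero
    exact HasProjectiveDimensionLT.subsingleton _ 0 i (Nat.zero_le _) _
  | quotient N p e =>
    have hp : p ∈ Module.support R N := by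
      rw [e.support_eq, Module.support_eq_zeroLocus, Ideal.annihilator_quotient]
      exact fun _ h ↦ h
    have := (hsupp p hp).1
    exact subsingleton_ext_congr_left e
      (IsRegularRing.subsingleton_ext_quotient p.asIdeal (hsupp p hp).2 i hi)
  | exact N₁ N₂ N₃ f g hf hg hfg h₁ h₃ =>
    have hex := ModuleCat.shortExact_of_function_exact hf hfg hg
    have h1 := h₁ fun p hp ↦ hsupp p (Module.support_subset_of_injective f hf hp)
    have h3 := h₃ fun p hp ↦ hsupp p (Module.support_subset_of_surjective g hg hp)
    refine subsingleton_of_forall_eq 0 fun e ↦ ?_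
    obtain ⟨y, hy⟩ := Ext.contravariant_sequence_exact₂ hex _ e (h1.elim _ _)
    rw [← hy, h3.elim y 0, Ext.comp_zero]

end ExtVanishing

/-! ### Local freeness expressed by scalars that factor through projectives. -/

section ScalarFactors

open CategoryTheory Abelian TensorProduct

variable {R : Type u} [CommRing R]

/-- Multiplication by `s` on `N` factors through a finite projective module. -/
def FactorsThroughProjective (s : R) (N : Type u) [AddCommGroup N] [Module R N] : Prop :=
  ∃ (F : Type u) (_ : AddCommGroup F) (_ : Module R F) (_ : Module.Finite R F)
    (_ : Module.Projective R F) (a : N →ₗ[R] F) (b : F →ₗ[R] N), b ∘ₗ a = s • LinearMap.id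

variable {N : Type u} [AddCommGroup N] [Module R N]

/-- A finite free cover splits over `R_p`. Clearing denominators, once to descend the section and
once to descend the identity it satisfies, gives `t * s`. -/
theorem exists_factorsThroughProjective_of_mem_freeLocus [IsNoetherianRing R] [Module.Finite R N]
    {p : PrimeSpectrum R} (hp : p ∈ Module.freeLocus R N) :
    ∃ s ∉ p.asIdeal, FactorsThroughProjective s N := by
  rw [Module.mem_freeLocus_iff_tensor p (Localization.AtPrime p.asIdeal)] at hp
  obtain ⟨F, _, _, _, _, π, hπ⟩ := Module.exists_finite_presentation R N
  have := Module.finitePresentation_of_finite R N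
  set A := Localization.AtPrime p.asIdeal
  obtain ⟨τ, hτ⟩ := Module.projective_lifting_property (π.baseChange A) LinearMap.id
    (by simpa using! LinearMap.lTensor_surjective A hπ)
  obtain ⟨σ, s, hσ⟩ := Module.FinitePresentation.exists_lift_of_isLocalizedModule
    p.asIdeal.primeCompl (TensorProduct.mk R A F 1)
    (τ.restrictScalars R ∘ₗ TensorProduct.mk R A N 1)
  obtain ⟨t, ht⟩ := Module.Finite.exists_smul_of_comp_eq_of_isLocalizedModule
    p.asIdeal.primeCompl (TensorProduct.mk R A N 1) (π ∘ₗ σ) (s • LinearMap.id) (by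
      ext v
      have h1 : (1 : A) ⊗ₜ[R] σ v = s • τ (1 ⊗ₜ v) := LinearMap.congr_fun hσ v
      have h2 := congrArg (π.baseChange A) h1
      have h3 : π.baseChange A (τ (1 ⊗ₜ v)) = 1 ⊗ₜ v := LinearMap.congr_fun hτ _
      simpa [Submonoid.smul_def, h3] using! h2)
  refine ⟨t * s, fun h ↦ (t * s).2 h, F, _, _, inferInstance, inferInstance, (t : R) • σ, π, ?_⟩
  rw [LinearMap.comp_smul, mul_smul]
  exact ht

theorem mem_freeLocus_of_factorsThroughProjective [IsNoetherianRing R] [Module.Finite R N]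
    {p : PrimeSpectrum R} {s : R} (hs : s ∉ p.asIdeal) (h : FactorsThroughProjective s N) :
    p ∈ Module.freeLocus R N := by
  obtain ⟨F, _, _, _, _, a, b, hab⟩ := h
  rw [Module.mem_freeLocus_iff_tensor p (Localization.AtPrime p.asIdeal)]
  set A := Localization.AtPrime p.asIdeal
  obtain ⟨u, hu⟩ := IsLocalization.map_units A (⟨s, hs⟩ : p.asIdeal.primeCompl)
  have hcomp : ((↑u⁻¹ : A) • b.baseChange A) ∘ₗ a.baseChange A = LinearMap.id := by
    rw [LinearMap.smul_comp, ← LinearMap.baseChange_comp, hab, LinearMap.baseChange_smul,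
      LinearMap.baseChange_id, ← algebraMap_smul A s, ← hu, smul_smul, Units.inv_mul, one_smul]
  have := Module.Projective.of_split _ _ hcomp
  exact Module.free_of_flat_of_isLocalRing

theorem FactorsThroughProjective.dual {s : R} (h : FactorsThroughProjective s N) :
    FactorsThroughProjective s (Module.Dual R N) := by
  obtain ⟨F, _, _, _, _, a, b, hab⟩ := h
  refine ⟨Module.Dual R F, _, _, inferInstance, inferInstance, b.dualMap, a.dualMap, ?_⟩
  ext φ v
  simpa using! congrArg φ (LinearMap.congr_fun hab v)

theorem FactorsThroughProjective.congr {N' : Type u} [AddCommGroup N'] [Module R N']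
    (e : N ≃ₗ[R] N') {s : R} (h : FactorsThroughProjective s N) :
    FactorsThroughProjective s N' := by
  obtain ⟨F, _, _, _, _, a, b, hab⟩ := h
  refine ⟨F, _, _, inferInstance, inferInstance, a ∘ₗ e.symm.toLinearMap,
    e.toLinearMap ∘ₗ b, ?_⟩
  ext v
  have := LinearMap.congr_fun hab (e.symm v)
  simpa using congrArg e this

/-- Lift `b` through `π` to `b'`; then `s - b' a π` lands in `ker π` and restricts to `s` there. In
effect `s` kills `Ext^1(N, -)`. -/
theorem FactorsThroughProjective.exists_retraction {s : R} (h : FactorsThroughProjective s N)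
    {P : Type u} [AddCommGroup P] [Module R P] {π : P →ₗ[R] N} (hπ : Function.Surjective π) :
    ∃ ψ : P →ₗ[R] LinearMap.ker π, ψ ∘ₗ (LinearMap.ker π).subtype = s • LinearMap.id := by
  obtain ⟨F, _, _, _, _, a, b, hab⟩ := h
  obtain ⟨b', hb'⟩ := Module.projective_lifting_property π b hπ
  let ψ : P →ₗ[R] P := s • LinearMap.id - b' ∘ₗ a ∘ₗ π
  have hker (v : P) : ψ v ∈ LinearMap.ker π := by
    have h1 : π (b' (a (π v))) = b (a (π v)) := LinearMap.congr_fun hb' _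
    have h2 : b (a (π v)) = s • π v := LinearMap.congr_fun hab _
    simp [ψ, h1, h2]
  refine ⟨ψ.codRestrict _ hker, ?_⟩
  ext v
  simp [ψ]

theorem FactorsThroughProjective.ker {s : R} (h : FactorsThroughProjective s N)
    {P : Type u} [AddCommGroup P] [Module R P] [Module.Finite R P] [Module.Projective R P]
    {π : P →ₗ[R] N} (hπ : Function.Surjective π) :
    FactorsThroughProjective s (LinearMap.ker π) := by
  obtain ⟨ψ, hψ⟩ := h.exists_retraction hπ
  exact ⟨P, _, _, inferInstance, inferInstance, _, ψ, hψ⟩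

end ScalarFactors

/-! ### Consequences of the long exact Ext sequence. -/

section Exactness

open CategoryTheory Abelian TensorProduct

variable {R : Type u} [CommRing R] {A B C : Type u} [AddCommGroup A] [Module R A]
  [AddCommGroup B] [Module R B] [AddCommGroup C] [Module R C] {f : A →ₗ[R] B} {g : B →ₗ[R] C}
  (hf : Function.Injective f) (hfg : Function.Exact f g) (hg : Function.Surjective g)

include hf hfg hg

theorem subsingleton_ext_of_exact_left (Y : ModuleCat.{u} R) (i : ℕ)
    (hB : Subsingleton (Ext (ModuleCat.of R B) Y i))
    (hC : Subsingleton (Ext (ModuleCat.of R C) Y (i + 1))) :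
    Subsingleton (Ext (ModuleCat.of R A) Y i) := by
  have hex := ModuleCat.shortExact_of_function_exact hf hfg hg
  refine subsingleton_of_forall_eq 0 fun e ↦ ?_
  obtain ⟨y, hy⟩ := Ext.contravariant_sequence_exact₁ hex Y e (add_comm 1 i) (hC.elim _ _)
  rw [← hy, hB.elim y 0, Ext.comp_zero]

theorem exists_comp_eq_of_subsingleton_ext_one {Y : Type u} [AddCommGroup Y] [Module R Y]
    (hC : Subsingleton (Ext (ModuleCat.of R C) (ModuleCat.of R Y) 1)) (φ : A →ₗ[R] Y) :
    ∃ ψ : B →ₗ[R] Y, ψ ∘ₗ f = φ := by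
  have hex := ModuleCat.shortExact_of_function_exact hf hfg hg
  obtain ⟨y, hy⟩ := Ext.contravariant_sequence_exact₁ hex (ModuleCat.of R Y)
    (Ext.mk₀ (ModuleCat.ofHom φ)) (add_comm 1 0) (hC.elim _ _)
  obtain ⟨ψ, rfl⟩ := (Ext.mk₀_bijective _ _).2 y
  rw [Ext.mk₀_comp_mk₀, (Ext.mk₀_bijective _ _).1.eq_iff] at hy
  exact ⟨ψ.hom, congrArg ModuleCat.Hom.hom hy⟩

end Exactness

/-! ### Duals of spherical modules. -/

section Spherical

open CategoryTheory Abelian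

variable {R : Type u} [CommRing R]

theorem Module.Projective.of_hasProjectiveDimensionLE_zero {N : Type u} [AddCommGroup N]
    [Module R N] (h : HasProjectiveDimensionLE (ModuleCat.of R N) 0) : Module.Projective R N := by
  rwa [IsProjective.iff_projective, projective_iff_hasProjectiveDimensionLE_zero]

theorem hasProjectiveDimensionLT_one_of_projective (N : Type u) [AddCommGroup N]
    [Module R N] [Module.Projective R N] : HasProjectiveDimensionLT (ModuleCat.of R N) 1 := by
  rw [← projective_iff_hasProjectiveDimensionLT_one, ← IsProjective.iff_projective]
  infer_instance

theorem subsingleton_ext_succ_of_projective (N : Type u) [AddCommGroup N] [Module R N]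
    [Module.Projective R N] (Y : ModuleCat.{u} R) (i : ℕ) :
    Subsingleton (Ext (ModuleCat.of R N) Y (i + 1)) :=
  have := hasProjectiveDimensionLT_one_of_projective (R := R) N
  HasProjectiveDimensionLT.subsingleton _ 1 _ (by omega) _

theorem IsSpherical.ker {e : ℕ} {N P : Type u} [AddCommGroup N] [Module R N]
    [AddCommGroup P] [Module R P] [Module.Projective R P] (hN : IsSpherical R (e + 1) N)
    {π : P →ₗ[R] N} (hπ : Function.Surjective π) : IsSpherical R e (LinearMap.ker π) := by
  have hproj : Projective π.shortComplexKer.X₂ := (IsProjective.iff_projective P).mp inferInstance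
  refine ⟨((LinearMap.shortExact_shortComplexKer hπ).hasProjectiveDimensionLT_X₃_iff e hproj).mp
    hN.1, fun i h1 hi ↦ ?_⟩
  obtain ⟨i, rfl⟩ := Nat.exists_eq_add_of_le' h1
  exact subsingleton_ext_of_exact_left (LinearMap.ker π).injective_subtype
    (LinearMap.exact_subtype_ker_map π) hπ _ _ (subsingleton_ext_succ_of_projective P _ i)
    (hN.2 _ (by omega) (by omega))

theorem LinearMap.exists_comp_eq_of_ker_le {A B Y : Type u} [AddCommGroup A] [Module R A]
    [AddCommGroup B] [Module R B] [AddCommGroup Y] [Module R Y] {f : A →ₗ[R] B}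
    (hf : Function.Surjective f) {φ : A →ₗ[R] Y} (h : LinearMap.ker f ≤ LinearMap.ker φ) :
    ∃ ψ : B →ₗ[R] Y, ψ ∘ₗ f = φ := by
  refine ⟨(LinearMap.ker f).liftQ φ h ∘ₗ (f.quotKerEquivOfSurjective hf).symm.toLinearMap, ?_⟩
  ext v
  have : (f.quotKerEquivOfSurjective hf).symm (f v) = Submodule.Quotient.mk v := by
    rw [LinearEquiv.symm_apply_eq]
    rfl
  rw [LinearMap.comp_apply, LinearMap.comp_apply, LinearEquiv.coe_coe, this,
    Submodule.liftQ_apply]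

variable {N P : Type u} [AddCommGroup N] [Module R N] [AddCommGroup P] [Module R P]
  {π : P →ₗ[R] N}

theorem exact_dualMap_dualMap_subtype_ker (hπ : Function.Surjective π) :
    Function.Exact π.dualMap (LinearMap.ker π).subtype.dualMap := by
  intro φ
  constructor
  · exact fun h ↦ LinearMap.exists_comp_eq_of_ker_le hπ
      fun v hv ↦ LinearMap.congr_fun h ⟨v, hv⟩
  · rintro ⟨ψ, rfl⟩
    ext v
    simp

variable {I C : Type u} [AddCommGroup I] [Module R I] [AddCommGroup C] [Module R C]
  {q : Module.Dual R P →ₗ[R] I} {j : I →ₗ[R] Module.Dual R (LinearMap.ker π)}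
  {c : Module.Dual R (LinearMap.ker π) →ₗ[R] C}

theorem exact_dualMap_of_comp_eq (hπ : Function.Surjective π) (hj : Function.Injective j)
    (hjq : j ∘ₗ q = (LinearMap.ker π).subtype.dualMap) : Function.Exact π.dualMap q := by
  intro φ
  rw [← exact_dualMap_dualMap_subtype_ker hπ φ, ← hjq, LinearMap.comp_apply,
    map_eq_zero_iff j hj]

/-- If `π p` dies in the bidual, evaluation at `p` descends to `I`, then extends to the dual of `ker
π`, where it is evaluation at some `k`. Reflexivity of `P` gives `p = k ∈ ker π`. -/
theorem injective_dual_eval_of_surjective_of_extension [Module.IsReflexive R P]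
    (hπ : Function.Surjective π)
    (hK : Function.Surjective (Module.Dual.eval R (LinearMap.ker π)))
    (hq : Function.Surjective q) (hj : Function.Injective j)
    (hjq : j ∘ₗ q = (LinearMap.ker π).subtype.dualMap)
    (hext : ∀ θ : Module.Dual R I, ∃ Θ : Module.Dual R (Module.Dual R (LinearMap.ker π)),
      Θ ∘ₗ j = θ) :
    Function.Injective (Module.Dual.eval R N) := by
  rw [injective_iff_map_eq_zero]
  intro n hn
  obtain ⟨p, rfl⟩ := hπ n
  have hker : LinearMap.ker q ≤ LinearMap.ker (Module.Dual.eval R P p) := by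
    intro φ hφ
    obtain ⟨ψ, rfl⟩ := (exact_dualMap_of_comp_eq hπ hj hjq φ).mp hφ
    exact LinearMap.congr_fun hn ψ
  obtain ⟨θ, hθ⟩ := LinearMap.exists_comp_eq_of_ker_le hq hker
  obtain ⟨Θ, hΘ⟩ := hext θ
  obtain ⟨k, rfl⟩ := hK Θ
  have hpk : p = k := by
    rw [← (Module.bijective_dual_eval R P).1.eq_iff, ← hθ, ← hΘ, LinearMap.comp_assoc, hjq]
    rfl
  rw [hpk]
  exact k.2

/-- Transfer of the homological properties of the dual from the kernel `K` of a finite free cover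
of `N` to `N` itself: `I` is the image and `C` the cokernel of the restriction map from `Dual R P`
to `Dual R K`. -/
theorem dual_properties_of_ker [Module.Free R P] [Module.Finite R P] {l e : ℕ} (he : e + 2 ≤ l)
    (hπ : Function.Surjective π) (hq : Function.Surjective q) (hj : Function.Injective j)
    (hjq : j ∘ₗ q = (LinearMap.ker π).subtype.dualMap) (hjc : Function.Exact j c)
    (hc : Function.Surjective c)
    (hCext : ∀ i < l, Subsingleton (Ext (ModuleCat.of R C) (ModuleCat.of R R) i))
    (hCpd : HasProjectiveDimensionLT (ModuleCat.of R C) (l - e + 1))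
    (hpd : HasProjectiveDimensionLE (ModuleCat.of R (Module.Dual R (LinearMap.ker π))) (l - e - 1))
    (hext : ∀ i, 1 ≤ i → i + e + 1 < l → Subsingleton
      (Ext (ModuleCat.of R (Module.Dual R (LinearMap.ker π))) (ModuleCat.of R R) i))
    (hsurj : Function.Surjective (Module.Dual.eval R (LinearMap.ker π))) :
    HasProjectiveDimensionLE (ModuleCat.of R (Module.Dual R N)) (l - (e + 1) - 1) ∧
    (∀ i, 1 ≤ i → i + (e + 1) + 1 < l →
      Subsingleton (Ext (ModuleCat.of R (Module.Dual R N)) (ModuleCat.of R R) i)) ∧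
    Function.Injective (Module.Dual.eval R N) ∧
    (e + 1 + 1 < l → Function.Surjective (Module.Dual.eval R N)) := by
  have hπ' : Function.Injective π.dualMap := LinearMap.dualMap_injective_of_surjective hπ
  have hπq := exact_dualMap_of_comp_eq hπ hj hjq
  have hIpd : HasProjectiveDimensionLT (ModuleCat.of R I) (l - e) :=
    (ModuleCat.shortExact_of_function_exact hj hjc hc).hasProjectiveDimensionLT_X₁ (l - e)
      (hasProjectiveDimensionLT_of_ge _ (l - e - 1 + 1) _ (by omega)) hCpd
  have hIext (i : ℕ) (hi : 1 ≤ i) (hil : i + e + 1 < l) :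
      Subsingleton (Ext (ModuleCat.of R I) (ModuleCat.of R R) i) :=
    subsingleton_ext_of_exact_left hj hjc hc _ _ (hext i hi hil) (hCext _ (by omega))
  refine ⟨?_, fun i hi hil ↦ ?_, ?_, fun hel θ ↦ ?_⟩
  · have hP := hasProjectiveDimensionLT_one_of_projective (R := R) (Module.Dual R P)
    have hN := (ModuleCat.shortExact_of_function_exact hπ' hπq
      hq).hasProjectiveDimensionLT_X₁ (l - e - 1) (hasProjectiveDimensionLT_of_ge _ 1 _ (by omega))
      (hasProjectiveDimensionLT_of_ge _ (l - e) _ (by omega))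
    exact hasProjectiveDimensionLT_of_ge _ (l - e - 1) _ (by omega)
  · obtain ⟨i, rfl⟩ := Nat.exists_eq_add_of_le' hi
    exact subsingleton_ext_of_exact_left hπ' hπq hq _ _
      (subsingleton_ext_succ_of_projective _ _ i) (hIext _ (by omega) (by omega))
  · exact injective_dual_eval_of_surjective_of_extension hπ hsurj hq hj hjq
      (exists_comp_eq_of_subsingleton_ext_one hj hjc hc (hCext 1 (by omega)))
  · obtain ⟨Θ, hΘ⟩ := exists_comp_eq_of_subsingleton_ext_one hπ' hπq hq
      (hIext 1 le_rfl (by omega)) θ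
    obtain ⟨p, rfl⟩ := (Module.bijective_dual_eval R P).2 Θ
    exact ⟨π p, by rw [← hΘ]; rfl⟩

theorem IsRegularRing.dual_of_isSpherical [IsRegularRing R] {l : ℕ} (hl : ringKrullDim R = l)
    (e : ℕ) (N : Type u) [AddCommGroup N] [Module R N] [Module.Finite R N]
    (hN : IsSpherical R e N)
    (hgood : ∀ p : PrimeSpectrum R, ¬(p.asIdeal.IsMaximal ∧ p.asIdeal.height = l) →
      ∃ s ∉ p.asIdeal, FactorsThroughProjective s N) (he : e + 1 ≤ l) :
    HasProjectiveDimensionLE (ModuleCat.of R (Module.Dual R N)) (l - e - 1) ∧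
    (∀ i, 1 ≤ i → i + e + 1 < l →
      Subsingleton (Ext (ModuleCat.of R (Module.Dual R N)) (ModuleCat.of R R) i)) ∧
    Function.Injective (Module.Dual.eval R N) ∧
    (e + 1 < l → Function.Surjective (Module.Dual.eval R N)) := by
  induction e generalizing N with
  | zero =>
    have := Module.Projective.of_hasProjectiveDimensionLE_zero hN.1
    have := hasProjectiveDimensionLT_one_of_projective (R := R) (Module.Dual R N)
    refine ⟨hasProjectiveDimensionLT_of_ge _ 1 _ (by omega), fun i hi _ ↦ ?_,
      (Module.bijective_dual_eval R N).1, fun _ ↦ (Module.bijective_dual_eval R N).2⟩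
    obtain ⟨i, rfl⟩ := Nat.exists_eq_add_of_le' hi
    exact subsingleton_ext_succ_of_projective _ _ i
  | succ e ih =>
    obtain ⟨P, _, _, _, _, π, hπ⟩ := Module.exists_finite_presentation R N
    obtain ⟨hpd, hext, -, hsurj⟩ := ih (LinearMap.ker π) (hN.ker hπ) (fun p hp ↦ by
      obtain ⟨s, hs, hs'⟩ := hgood p hp
      exact ⟨s, hs, hs'.ker hπ⟩) (by omega)
    set ρ : Module.Dual R P →ₗ[R] Module.Dual R (LinearMap.ker π) :=
      (LinearMap.ker π).subtype.dualMap with hρ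
    have hC := (LinearMap.range ρ).mkQ_surjective
    -- At a good prime, `φ ∘ₗ ψ` extends `s • φ` to `P`, so `s` kills the cokernel.
    have hCsupp : ∀ p ∈ Module.support R (Module.Dual R (LinearMap.ker π) ⧸ LinearMap.range ρ),
        p.asIdeal.IsMaximal ∧ p.asIdeal.height = l := by
      intro p hp
      by_contra hcon
      obtain ⟨s, hs, hs'⟩ := hgood p hcon
      obtain ⟨ψ, hψ⟩ := hs'.exists_retraction hπ
      refine Module.notMem_support_iff'.mpr (fun c ↦ ⟨s, hs, ?_⟩) hp
      obtain ⟨φ, rfl⟩ := hC c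
      rw [← map_smul, Submodule.mkQ_apply, Submodule.Quotient.mk_eq_zero]
      refine ⟨φ ∘ₗ ψ, ?_⟩
      ext v
      simpa using! congrArg φ (LinearMap.congr_fun hψ v)
    have hCpd : HasProjectiveDimensionLT
        (ModuleCat.of R (Module.Dual R (LinearMap.ker π) ⧸ LinearMap.range ρ)) (l - e + 1) := by
      -- For `e = 0` only the bound by `l` is available; for larger `e`, `Ext^1(N, R) = 0` makes the
      -- cokernel zero.
      rcases e with _ | e
      · exact IsRegularRing.hasProjectiveDimensionLE hl.le _
      · have hρs : LinearMap.range ρ = ⊤ := by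
          rw [LinearMap.range_eq_top]
          exact exists_comp_eq_of_subsingleton_ext_one (LinearMap.ker π).injective_subtype
            (LinearMap.exact_subtype_ker_map π) hπ (hN.2 1 le_rfl (by omega))
        have : Subsingleton (Module.Dual R (LinearMap.ker π) ⧸ LinearMap.range ρ) :=
          Submodule.Quotient.subsingleton_iff.mpr hρs
        have := (ModuleCat.isZero_of_subsingleton (ModuleCat.of R
          (Module.Dual R (LinearMap.ker π) ⧸ LinearMap.range ρ))).hasProjectiveDimensionLT_zero
        exact hasProjectiveDimensionLT_of_ge _ 0 _ (Nat.zero_le _)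
    exact dual_properties_of_ker he hπ ρ.surjective_rangeRestrict
      (LinearMap.range ρ).injective_subtype rfl (LinearMap.exact_subtype_mkQ _) hC
      (IsRegularRing.subsingleton_ext_of_support_subset _ hCsupp) hCpd hpd hext
      (hsurj (by omega))

/-! ### Syzygies and the non-free locus. -/

/-- The sequence of modules `Q, P 0, P 1, …`. -/
def ModuleCat.consSeq (Q : ModuleCat.{u} R) (P : ℕ → ModuleCat.{u} R) : ℕ → ModuleCat.{u} R
  | 0 => Q
  | i + 1 => P i

/-- Surjectivity of `g` serves only for exactness at the second projective, which is not demanded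
when `r = 1`. This exception covers the end of a dualized resolution, where `Ext^1` may be nonzero.
-/
theorem IsSyzygy.of_exact {r : ℕ} {A Q B : Type u} [AddCommGroup A] [Module R A]
    [AddCommGroup Q] [Module R Q] [Module.Projective R Q] [AddCommGroup B] [Module R B]
    {f : A →ₗ[R] Q} {g : Q →ₗ[R] B} (hf : Function.Injective f) (hfg : Function.Exact f g)
    (hg : r = 1 ∨ Function.Surjective g) (hB : IsSyzygy R r B) :
    IsSyzygy R (r + 1) A := by
  obtain ⟨P, ι, δ, hP, hι, hι0, hδ⟩ := hB
  let δ' : ∀ i : ℕ, ModuleCat.consSeq (ModuleCat.of R Q) P i →ₗ[R]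
      ModuleCat.consSeq (ModuleCat.of R Q) P (i + 1)
    | 0 => ι ∘ₗ g
    | i + 1 => δ i
  refine ⟨ModuleCat.consSeq (ModuleCat.of R Q) P, f, δ', fun i hi ↦ ?_, hf, fun _ ↦ ?_, fun i hi ↦ ?_⟩
  · rcases i with _ | i
    · exact ‹Module.Projective R Q›
    · exact hP i (by omega)
  · exact hfg.comp_injective ι hι (map_zero ι)
  · rcases i with _ | i
    · have hg := hg.resolve_left (by omega)
      have hex : Function.Exact (ι ∘ₗ g) (δ 0) := fun x ↦ by
        rw [hι0 (by omega) x, LinearMap.coe_comp, hg.range_comp]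
      exact hex
    · exact hδ i (by omega)

theorem isSyzygy_one_of_injective {A Q : Type u} [AddCommGroup A] [Module R A]
    [AddCommGroup Q] [Module R Q] [Module.Projective R Q] {f : A →ₗ[R] Q}
    (hf : Function.Injective f) : IsSyzygy R 1 A :=
  ⟨fun _ ↦ ModuleCat.of R Q, f, fun _ ↦ 0, fun _ _ ↦ ‹_›, hf, fun h ↦ absurd h (by omega),
    fun i hi ↦ absurd hi (by omega)⟩

theorem IsSyzygy.congr {r : ℕ} {A B : Type u} [AddCommGroup A] [Module R A]
    [AddCommGroup B] [Module R B] (e : A ≃ₗ[R] B) (hB : IsSyzygy R r B) : IsSyzygy R r A := by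
  obtain ⟨P, ι, δ, hP, hι, hι0, hδ⟩ := hB
  refine ⟨P, ι ∘ₗ e.toLinearMap, δ, hP, hι.comp e.injective, fun h x ↦ ?_, hδ⟩
  rw [hι0 h x]
  exact ⟨fun ⟨b, hb⟩ ↦ ⟨e.symm b, by simpa using hb⟩, fun ⟨a, ha⟩ ↦ ⟨e a, ha⟩⟩

theorem IsSpherical.isSyzygy_dual [IsNoetherianRing R] (e : ℕ) (N : Type u) [AddCommGroup N]
    [Module R N] [Module.Finite R N] (hN : IsSpherical R e N) :
    IsSyzygy R (e + 1) (Module.Dual R N) := by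
  induction e generalizing N with
  | zero =>
    have := Module.Projective.of_hasProjectiveDimensionLE_zero hN.1
    exact isSyzygy_one_of_injective (f := (LinearMap.id : Module.Dual R N →ₗ[R] _))
      Function.injective_id
  | succ e ih =>
    obtain ⟨P, _, _, _, _, π, hπ⟩ := Module.exists_finite_presentation R N
    refine (ih (LinearMap.ker π) (hN.ker hπ)).of_exact
      (LinearMap.dualMap_injective_of_surjective hπ) (exact_dualMap_dualMap_subtype_ker hπ) ?_
    rcases e with _ | e
    · exact .inl rfl
    · exact .inr <| exists_comp_eq_of_subsingleton_ext_one (LinearMap.ker π).injective_subtype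
        (LinearMap.exact_subtype_ker_map π) hπ (hN.2 1 le_rfl (by omega))

/-- The locus is closed, so it contains a maximal ideal above `p`; a strict inclusion would give a
chain of two irreducible closed subsets. -/
theorem isMaximal_of_mem_nonFreeLocus [IsNoetherianRing R] {M : Type u} [AddCommGroup M]
    [Module R M] [Module.Finite R M] (h : HasZeroDimNonFreeLocus R M) {p : PrimeSpectrum R}
    (hp : p ∈ nonFreeLocus R M) : p.asIdeal.IsMaximal := by
  have := Module.finitePresentation_of_finite R M
  have hclosed : IsClosed (nonFreeLocus R M) := Module.isOpen_freeLocus.isClosed_compl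
  obtain ⟨m, hm, hpm⟩ := p.asIdeal.exists_le_maximal p.isPrime.ne_top
  let q : PrimeSpectrum R := ⟨m, hm.isPrime⟩
  have hq : q ∈ nonFreeLocus R M :=
    hclosed.stableUnderSpecialization ((PrimeSpectrum.le_iff_specializes p q).mp hpm) hp
  let cl (x : nonFreeLocus R M) : TopologicalSpace.IrreducibleCloseds (nonFreeLocus R M) :=
    ⟨closure {x}, isIrreducible_singleton.closure, isClosed_closure⟩
  have hle : cl ⟨q, hq⟩ ≤ cl ⟨p, hp⟩ := by
    refine closure_minimal (Set.singleton_subset_iff.mpr ?_) isClosed_closure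
    refine specializes_iff_mem_closure.mp (Topology.IsInducing.subtypeVal.specializes_iff.mp ?_)
    exact (PrimeSpectrum.le_iff_specializes p q).mp hpm
  have hge : cl ⟨p, hp⟩ ≤ cl ⟨q, hq⟩ :=
    Order.krullDim_nonpos_iff_forall_isMax.mp (le_of_eq h) _ hle
  have hqp : (⟨q, hq⟩ : nonFreeLocus R M) ⤳ ⟨p, hp⟩ :=
    specializes_iff_mem_closure.mpr (hge (subset_closure rfl))
  have : q ≤ p := (PrimeSpectrum.le_iff_specializes q p).mpr (Topology.IsInducing.subtypeVal.specializes_iff.mpr hqp)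
  rwa [le_antisymm hpm this]

end Spherical

/-! ### The main theorem. -/

theorem mainTheorem7 {R : Type u} [CommRing R] [IsRegularRing R] (l d : ℕ)
    (hl : ringKrullDim R = l) (hd : 0 < d) (hdl : d < l)
    (M : Type u) [AddCommGroup M] [Module R M] [Module.Finite R M]
    (hM : IsSpherical R d M) (hM0 : HasZeroDimNonFreeLocus R M)
    (hht : ∀ p ∈ nonFreeLocus R M, p.asIdeal.IsMaximal → p.asIdeal.height = l) :
    (d + 1 < l → Module.IsReflexive R M) ∧
    IsSpherical R (l - d - 1) (Module.Dual R M) ∧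
    (d + 1 < l → HasZeroDimNonFreeLocus R (Module.Dual R M)) ∧
    IsSyzygy R (l - d) M ∧
    IsSyzygy R (d + 1) (Module.Dual R M) := by
  have hgood (p : PrimeSpectrum R) (hp : ¬(p.asIdeal.IsMaximal ∧ p.asIdeal.height = l)) :
      ∃ s ∉ p.asIdeal, FactorsThroughProjective s M := by
    refine exists_factorsThroughProjective_of_mem_freeLocus (by_contra fun h ↦ hp ?_)
    have hmax := isMaximal_of_mem_nonFreeLocus hM0 h
    exact ⟨hmax, hht p h hmax⟩
  obtain ⟨hpd, hext, hinj, hsurj⟩ := IsRegularRing.dual_of_isSpherical hl d M hM hgood hdl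
  have hsph : IsSpherical R (l - d - 1) (Module.Dual R M) :=
    ⟨hpd, fun i hi hil ↦ hext i hi (by omega)⟩
  refine ⟨fun h ↦ ⟨hinj, hsurj h⟩, hsph, fun h ↦ ?_, ?_, hM.isSyzygy_dual⟩
  -- Factorizations pass to duals, and `M` is the dual of its dual, so the two loci agree.
  · have hlocus : nonFreeLocus R (Module.Dual R M) = nonFreeLocus R M := by
      refine congrArg _ (Set.Subset.antisymm (fun p hp ↦ ?_) fun p hp ↦ ?_)
      · obtain ⟨s, hs, hs'⟩ := exists_factorsThroughProjective_of_mem_freeLocus hp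
        exact mem_freeLocus_of_factorsThroughProjective hs
          (hs'.dual.congr (LinearEquiv.ofBijective _ ⟨hinj, hsurj h⟩).symm)
      · obtain ⟨s, hs, hs'⟩ := exists_factorsThroughProjective_of_mem_freeLocus hp
        exact mem_freeLocus_of_factorsThroughProjective hs hs'.dual
    rwa [HasZeroDimNonFreeLocus, hlocus]
  · rcases (show d + 1 ≤ l from hdl).lt_or_eq with h | h
    · have := hsph.isSyzygy_dual
      rw [show l - d - 1 + 1 = l - d by omega] at this
      exact this.congr (LinearEquiv.ofBijective _ ⟨hinj, hsurj h⟩)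
    -- When `d = l - 1` biduality is only known to be injective, but a `1`-syzygy only needs `M ↪
    -- M^∨∨ ↪ P^∨`.
    · obtain ⟨P, _, _, _, _, π, hπ⟩ := Module.exists_finite_presentation R (Module.Dual R M)
      rw [show l - d = 1 by omega]
      exact isSyzygy_one_of_injective (f := π.dualMap ∘ₗ Module.Dual.eval R M)
        ((LinearMap.dualMap_injective_of_surjective hπ).comp hinj)
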